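/- Let $\log\Gamma$ denote the analytic branch of the logarithm of the Gamma function on $\mathbb{C}\setminus(-\infty,0]$ that is real on the positive real axis, let $\log z$ be the principal logarithm, and let Binet's function be \[ \mu(z)=\log\Gamma(z)-\left(z-\tfrac12\right)\log z+z-\tfrac12\log(2\pi). \] Let $S_m^{(k)}$ denote the (signed) Stirling numbers of the first kind, $\prod_{j=0}^{m-1}(x-j)=\sum_{k=0}^{m}S_m^{(k)}x^k$. For integers $m\ge 1$ define the Binet polynomials \[ b_m(\alpha)=\frac1m\sum_{k=1}^{m}\left\{\frac{\alpha^{k+2}-(\alpha-1)^{k+2}}{k+2}+\frac{\left(\frac12-\alpha\right)\left(\alpha^{k+1}-(\alpha-1)^{k+1}\right)}{k+1}\right\}(-1)^{k-m}S_m^{(k)} \] and the coefficients \[ c_m=\frac{(-1)^{m-1}}{2m}\sum_{k=1}^{m}\frac{k\,S_m^{(k)}}{(k+2)(k+1)} . \] Then for all complex $z$ and $\alpha$ with $\operatorname{Re}(z)>0$ and $\operatorname{Re}(\alpha)>-\operatorname{Re}(z)$ the (absolutely) convergent factorial expansion \[ \mu(z)=\sum_{m=1}^{\infty}\frac{b_m(\alpha)}{\prod_{k=0}^{m-1}(z+\alpha+k)}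 \] holds. Moreover, for all $m\ge1$ and all $\alpha\in\mathbb{C}$, one has $c_m=b_m(0)$, \[ b_m(\alpha)=c_m+\alpha\sum_{k=1}^{m-1}\binom{m-1}{k-1}\left(\prod_{j=1}^{m-k-1}(\alpha+j)\right)c_k, \qquad b_m(\alpha)=\frac1m\int_{\alpha-1}^{\alpha}\left(x+\tfrac12-\alpha\right)\prod_{k=0}^{m-1}(k+x)\,dx , \] where the integral is taken along the straight segment from $\alpha-1$ to $\alpha$. In particular, $b_1(\alpha)=\frac1{12}$ and $b_2(\alpha)=\frac{\alpha}{12}$. -/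

import Mathlib

open Finset

/-- The complex integral `∫_a^b f(x) dx` along the straight segment from `a` to `b`. -/
noncomputable def segmentIntegral (f : ℂ → ℂ) (a b : ℂ) : ℂ :=
  ∫ t in (0 : ℝ)..1, f (a + (t : ℂ) * (b - a)) * (b - a)

/-- The analytic logarithm `log Γ(z)` of the Gamma function on the complex plane cut along
`(-∞, 0]`: the primitive of the digamma function `Γ'/Γ` that vanishes at `z = 1` (where
`Γ(1) = 1`). On the positive real axis it is the real logarithm of `Γ`. In general it is not
the principal logarithm of the number `Γ(z)`. -/
noncomputable def logGamma (z : ℂ) : ℂ :=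
  segmentIntegral Complex.digamma 1 z

/-- Binet's function `μ(z) = log Γ(z) - (z - 1/2) log z + z - (1/2) log (2π)`. -/
noncomputable def binetMu (z : ℂ) : ℂ :=
  logGamma z - (z - 1 / 2) * Complex.log z + z - 1 / 2 * (Real.log (2 * Real.pi) : ℂ)

/-- The (signed) Stirling number of the first kind `S_m^{(k)}`. -/
def signedStirlingFirst (m k : ℕ) : ℤ :=
  (-1) ^ (m + k) * (Nat.stirlingFirst m k : ℤ)

/-- The generating function `∏_{j=0}^{m-1} (x - j) = ∑_{k=0}^m S_m^{(k)} x^k`. -/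
theorem prod_sub_eq_sum_signedStirlingFirst (x : ℂ) (m : ℕ) :
    ∏ j ∈ range m, (x - (j : ℂ)) =
      ∑ k ∈ range (m + 1), (signedStirlingFirst m k : ℂ) * x ^ k := by
  induction m with
  | zero => simp [signedStirlingFirst]
  | succ m ih =>
    rw [prod_range_succ, ih, sum_range_succ' _ (m + 1)]
    have h0 : (signedStirlingFirst (m + 1) 0 : ℂ) = 0 := by simp [signedStirlingFirst]
    have h1 : ∀ k : ℕ, (signedStirlingFirst (m + 1) (k + 1) : ℂ) * x ^ (k + 1) =
        (signedStirlingFirst m k : ℂ) * x ^ k * x -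
          m * ((signedStirlingFirst m (k + 1) : ℂ) * x ^ (k + 1)) := by
      intro k
      simp only [signedStirlingFirst, Nat.stirlingFirst_succ_succ]
      push_cast
      ring
    have h2 : (signedStirlingFirst m (m + 1) : ℂ) = 0 := by
      simp [signedStirlingFirst, Nat.stirlingFirst_eq_zero_of_lt (Nat.lt_succ_self m)]
    have h3 : (m : ℂ) * (signedStirlingFirst m 0 : ℂ) = 0 := by
      cases m <;> simp [signedStirlingFirst]
    have h4 : ∑ k ∈ range (m + 1), (signedStirlingFirst m (k + 1) : ℂ) * x ^ (k + 1) +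
        (signedStirlingFirst m 0 : ℂ) =
        ∑ k ∈ range (m + 1), (signedStirlingFirst m k : ℂ) * x ^ k := by
      have h5 := sum_range_succ' (fun k => (signedStirlingFirst m k : ℂ) * x ^ k) (m + 1)
      rw [sum_range_succ, h2] at h5
      simpa using h5.symm
    simp only [h1, h0, sum_sub_distrib, ← sum_mul, ← mul_sum]
    linear_combination (m : ℂ) * h4 - h3

/-- The coefficients
`c_m = ((-1)^(m-1) / (2m)) ∑_{k=1}^m k S_m^{(k)} / ((k+2)(k+1))`, for `m ≥ 1`. -/
noncomputable def binetCoeff (m : ℕ) : ℂ :=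
  (-1) ^ (m - 1) / (2 * (m : ℂ)) *
    ∑ k ∈ Icc 1 m, (k : ℂ) * (signedStirlingFirst m k : ℂ) / (((k : ℂ) + 2) * ((k : ℂ) + 1))

open Polynomial in
/-- The Binet polynomial `b_m`, for `m ≥ 1`: with `X` standing for the parameter `α`,
`(1/m) ∑_{k=1}^m { (α^(k+2) - (α-1)^(k+2))/(k+2)
  + (1/2 - α)(α^(k+1) - (α-1)^(k+1))/(k+1) } (-1)^(k-m) S_m^{(k)}`. -/
noncomputable def binetPoly (m : ℕ) : ℂ[X] :=
  C (1 / (m : ℂ)) * ∑ k ∈ Icc 1 m,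
    (C (1 / ((k : ℂ) + 2)) * (X ^ (k + 2) - (X - 1) ^ (k + 2)) +
      C (1 / ((k : ℂ) + 1)) * ((C (1 / 2) - X) * (X ^ (k + 1) - (X - 1) ^ (k + 1)))) *
    C ((-1) ^ (m - k) * (signedStirlingFirst m k : ℂ))

/-! Write `(x)_m` for the rising factorial. Gudermann's series gives `μ(z) = ∑_n g(z + n)`, where
`g(z) = (z + 1/2) log((z+1)/z) - 1 = ∫_0^1 (1/2 - t)/(z + t) dt`. With `w = z + α` and `x = α - t`,
the kernel `1/(z + t) = 1/(w - x)` expands as `∑_m (x)_m / (w)_{m+1}`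
(`sum_risingProd_div_risingProd`). Hence `g(z) = ∑_m M_m(α) / (z + α)_{m+1}` with the moments
`M_m(α) = ∫_0^1 (1/2 - t) (α - t)_m dt`, and `M_0 = 0`. Replacing `z` by `z + n` and summing over
`n` telescopes: `∑_n 1/(w + n)_{m+1} = 1/(m (w)_m)` for `m ≥ 1`. Since `b_m = M_m / m`, this is the
expansion.

The interchange of sums rests on `‖M_m(α)‖ ≤ C (v)_m` for a real `v` with `max(0, Re α) < v < Re(z +
α)` (`exists_norm_risingProd_sub_le`). The algebraic formulas for `b_m` all come from the moment
integral: expand `(x)_m` in powers, reverse the segment, or apply Vandermonde's identity. -/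

open Filter Topology

/-! ### Rising factorials and Stirling numbers -/

/-- The rising factorial `x (x + 1) ⋯ (x + m - 1)`. -/
def risingProd {R : Type*} [CommSemiring R] (m : ℕ) (x : R) : R :=
  ∏ k ∈ range m, (x + (k : R))

theorem risingProd_zero {R : Type*} [CommSemiring R] (x : R) : risingProd 0 x = 1 := by
  simp [risingProd]

theorem risingProd_succ {R : Type*} [CommSemiring R] (m : ℕ) (x : R) :
    risingProd (m + 1) x = risingProd m x * (x + m) := by
  simp [risingProd, prod_range_succ]

theorem risingProd_succ_left {R : Type*} [CommSemiring R] (m : ℕ) (x : R) :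
    risingProd (m + 1) x = x * risingProd m (x + 1) := by
  simp only [risingProd, prod_range_succ', Nat.cast_zero, add_zero]
  rw [mul_comm]
  congr 1
  refine prod_congr rfl fun k _ => ?_
  push_cast
  ring

theorem risingProd_eq_sum_stirlingFirst (x : ℂ) (m : ℕ) :
    risingProd m x = ∑ k ∈ range (m + 1), (Nat.stirlingFirst m k : ℂ) * x ^ k := by
  have h := prod_sub_eq_sum_signedStirlingFirst (-x) m
  have h1 : ∏ j ∈ range m, (-x - (j : ℂ)) = (-1) ^ m * risingProd m x := by
    rw [risingProd, ← card_range m, ← prod_const, card_range, ← prod_mul_distrib]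
    exact prod_congr rfl fun k _ => by ring
  have h2 : ((-1 : ℂ) ^ m) * (-1) ^ m = 1 := by rw [← mul_pow]; simp
  rw [h1] at h
  calc risingProd m x = (-1) ^ m * ((-1) ^ m * risingProd m x) := by
        rw [← mul_assoc, h2, one_mul]
    _ = _ := by
        rw [h, mul_sum]
        refine sum_congr rfl fun k _ => ?_
        have h3 : ((-1 : ℂ) ^ k) * (-1) ^ k = 1 := by rw [← mul_pow]; simp
        simp only [signedStirlingFirst, neg_pow x k, pow_add]
        push_cast
        linear_combination (Nat.stirlingFirst m k : ℂ) * x ^ k * ((-1) ^ k * (-1) ^ k) * h2 +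
          (Nat.stirlingFirst m k : ℂ) * x ^ k * h3

theorem neg_one_pow_sub_mul_signedStirlingFirst {m k : ℕ} (h : k ≤ m) :
    (-1 : ℂ) ^ (m - k) * (signedStirlingFirst m k : ℂ) = Nat.stirlingFirst m k := by
  obtain ⟨d, rfl⟩ := Nat.exists_eq_add_of_le h
  have h2 : (-1 : ℂ) ^ d * (-1) ^ (k + d + k) = 1 := by
    rw [← pow_add]; exact Even.neg_one_pow ⟨k + d, by ring⟩
  simp only [signedStirlingFirst, Nat.add_sub_cancel_left]
  push_cast
  linear_combination (Nat.stirlingFirst (k + d) k : ℂ) * h2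

/-- Vandermonde's identity. In the induction the new factor splits as `(y + k) + (x + (m - k))`, and
Pascal's rule recombines the two sums. -/
theorem risingProd_add (m : ℕ) (x y : ℂ) :
    risingProd m (x + y) =
      ∑ k ∈ range (m + 1), (m.choose k : ℂ) * risingProd k y * risingProd (m - k) x := by
  induction m generalizing x y with
  | zero => simp [risingProd]
  | succ m ih =>
    rw [risingProd_succ, ih, sum_mul]
    have h : ∀ k ∈ range (m + 1),
        (m.choose k : ℂ) * risingProd k y * risingProd (m - k) x * (x + y + m) =
        (m.choose k : ℂ) * risingProd (k + 1) y * risingProd (m - k) x +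
          (m.choose k : ℂ) * risingProd k y * risingProd (m + 1 - k) x := by
      intro k hk
      have hk : k ≤ m := by simpa [Nat.lt_succ_iff] using hk
      rw [Nat.succ_sub hk, risingProd_succ, risingProd_succ, Nat.cast_sub hk]
      ring
    rw [sum_congr rfl h, sum_add_distrib, sum_range_succ' _ (m + 1)]
    have h2 : ∀ k : ℕ, ((m + 1).choose (k + 1) : ℂ) * risingProd (k + 1) y *
        risingProd (m + 1 - (k + 1)) x =
        (m.choose k : ℂ) * risingProd (k + 1) y * risingProd (m - k) x +
        (m.choose (k + 1) : ℂ) * risingProd (k + 1) y * risingProd (m + 1 - (k + 1)) x := by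
      intro k
      rw [Nat.choose_succ_succ, Nat.add_sub_add_right]
      push_cast
      ring
    simp only [h2, sum_add_distrib]
    have h3 := sum_range_succ' (fun k => (m.choose k : ℂ) * risingProd k y *
      risingProd (m + 1 - k) x) (m + 1)
    rw [sum_range_succ] at h3
    simp only [Nat.choose_succ_self, Nat.cast_zero, zero_mul, add_zero] at h3
    rw [h3]
    simp only [Nat.choose_zero_right]
    ring

/-! ### Moments and Binet polynomials -/

/-- The moment `∫_0^1 (1/2 - t) (α - t)_m dt` of the rising factorial. -/
noncomputable def risingMoment (m : ℕ) (α : ℂ) : ℂ :=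
  ∫ t in (0 : ℝ)..1, (1 / 2 - (t : ℂ)) * risingProd m (α - t)

theorem continuous_risingProd (m : ℕ) : Continuous (risingProd m : ℂ → ℂ) := by
  unfold risingProd
  fun_prop

/-- The two fractions come from `1/2 - t = (α - t) + (1/2 - α)`. -/
theorem integral_half_sub_mul_pow (α : ℂ) (k : ℕ) :
    ∫ t in (0 : ℝ)..1, (1 / 2 - (t : ℂ)) * (α - t) ^ k =
      (α ^ (k + 2) - (α - 1) ^ (k + 2)) / ((k : ℂ) + 2) +
        (1 / 2 - α) * (α ^ (k + 1) - (α - 1) ^ (k + 1)) / ((k : ℂ) + 1) := by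
  have hk1 : (k : ℂ) + 1 ≠ 0 := by exact_mod_cast Nat.succ_ne_zero k
  have hk2 : (k : ℂ) + 2 ≠ 0 := by exact_mod_cast Nat.succ_ne_zero (k + 1)
  have h : ∀ t : ℝ, HasDerivAt (fun t : ℝ => -((α - t) ^ (k + 2) / ((k : ℂ) + 2) +
      (1 / 2 - α) * (α - t) ^ (k + 1) / ((k : ℂ) + 1))) ((1 / 2 - (t : ℂ)) * (α - t) ^ k) t := by
    intro t
    have h0 : HasDerivAt (fun t : ℝ => α - (t : ℂ)) (-1) t := by
      simpa using (Complex.ofRealCLM.hasDerivAt (x := t)).const_sub α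
    have h1 := (((h0.pow (k + 2)).div_const ((k : ℂ) + 2)).add
      (((h0.pow (k + 1)).const_mul (1 / 2 - α)).div_const ((k : ℂ) + 1))).neg
    refine h1.congr_deriv ?_
    rw [show k + 2 - 1 = k + 1 from rfl, show k + 1 - 1 = k from rfl]
    push_cast
    field_simp
    ring
  rw [intervalIntegral.integral_eq_sub_of_hasDerivAt (fun t _ => h t)
    (Continuous.intervalIntegrable (by fun_prop) _ _)]
  simp
  ring

theorem risingMoment_zero (α : ℂ) : risingMoment 0 α = 0 := by
  have h := integral_half_sub_mul_pow α 0
  simp only [risingMoment, risingProd_zero]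
  simp only [pow_zero] at h
  rw [h]
  norm_num
  ring

theorem risingMoment_eq_sum {m : ℕ} (hm : 1 ≤ m) (α : ℂ) :
    risingMoment m α = ∑ k ∈ Icc 1 m,
        ((α ^ (k + 2) - (α - 1) ^ (k + 2)) / ((k : ℂ) + 2) +
          (1 / 2 - α) * (α ^ (k + 1) - (α - 1) ^ (k + 1)) / ((k : ℂ) + 1)) *
        (-1) ^ (m - k) * (signedStirlingFirst m k : ℂ) := by
  simp only [risingMoment, risingProd_eq_sum_stirlingFirst, mul_sum]
  rw [intervalIntegral.integral_finsetSum
    (fun k _ => Continuous.intervalIntegrable (by fun_prop) _ _)]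
  rw [range_eq_Ico, sum_eq_sum_Ico_succ_bot (by omega)]
  obtain ⟨d, rfl⟩ := Nat.exists_eq_add_of_le' hm
  simp only [Nat.stirlingFirst_succ_zero, Nat.cast_zero, zero_mul, mul_zero,
    intervalIntegral.integral_zero, zero_add]
  refine sum_congr (Ico_add_one_right_eq_Icc 1 (d + 1)) fun k hk => ?_
  have hk : k ≤ d + 1 := (mem_Icc.1 hk).2
  rw [mul_assoc, neg_one_pow_sub_mul_signedStirlingFirst hk, ← integral_half_sub_mul_pow,
    ← intervalIntegral.integral_mul_const]
  congr 1
  ext t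
  ring

theorem binetPoly_eval (m : ℕ) (α : ℂ) :
    (binetPoly m).eval α = 1 / (m : ℂ) * ∑ k ∈ Icc 1 m,
        ((α ^ (k + 2) - (α - 1) ^ (k + 2)) / ((k : ℂ) + 2) +
          (1 / 2 - α) * (α ^ (k + 1) - (α - 1) ^ (k + 1)) / ((k : ℂ) + 1)) *
        (-1) ^ (m - k) * (signedStirlingFirst m k : ℂ) := by
  simp only [binetPoly, Polynomial.eval_mul, Polynomial.eval_C, Polynomial.eval_finsetSum,
    Polynomial.eval_add, Polynomial.eval_sub, Polynomial.eval_pow, Polynomial.eval_X,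
    Polynomial.eval_one]
  congr 1
  refine sum_congr rfl fun k _ => ?_
  ring

theorem binetPoly_eval_eq_risingMoment {m : ℕ} (hm : 1 ≤ m) (α : ℂ) :
    (binetPoly m).eval α = 1 / (m : ℂ) * risingMoment m α := by
  rw [binetPoly_eval, risingMoment_eq_sum hm]

theorem binetPoly_eval_eq_segmentIntegral {m : ℕ} (hm : 1 ≤ m) (α : ℂ) :
    (binetPoly m).eval α = 1 / (m : ℂ) *
      segmentIntegral (fun x => (x + (1 / 2 - α)) * ∏ k ∈ range m, ((k : ℂ) + x)) (α - 1) α := by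
  rw [binetPoly_eval_eq_risingMoment hm]
  congr 1
  -- The substitution `t ↦ 1 - t` reverses the path, so that it runs from `α - 1` to `α`.
  have h := intervalIntegral.integral_comp_sub_left (a := 0) (b := 1)
    (fun t : ℝ => (1 / 2 - (t : ℂ)) * risingProd m (α - t)) 1
  simp only [sub_self, sub_zero] at h
  rw [risingMoment, ← h, segmentIntegral]
  congr 1
  ext t
  simp only [risingProd]
  push_cast
  rw [prod_congr rfl (g := fun k : ℕ => (k : ℂ) + (α - 1 + t * (α - (α - 1))))
    (fun k _ => by ring)]
  ring

theorem binetCoeff_eq_eval_zero (m : ℕ) : binetCoeff m = (binetPoly m).eval 0 := by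
  rw [binetPoly_eval, binetCoeff, mul_sum, mul_sum]
  refine sum_congr rfl fun k hk => ?_
  obtain ⟨hk1, hk2⟩ := mem_Icc.1 hk
  obtain ⟨d, rfl⟩ := Nat.exists_eq_add_of_le hk2
  obtain ⟨j, rfl⟩ := Nat.exists_eq_add_of_le' hk1
  have h1 : ((j + 1 : ℕ) : ℂ) + 1 ≠ 0 := by exact_mod_cast Nat.succ_ne_zero (j + 1)
  have h2 : ((j + 1 : ℕ) : ℂ) + 2 ≠ 0 := by exact_mod_cast Nat.succ_ne_zero (j + 2)
  have h3 : ((j + 1 + d : ℕ) : ℂ) ≠ 0 := Nat.cast_ne_zero.2 (by omega)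
  have h4 : ((-1 : ℂ) ^ j) * (-1) ^ j = 1 := by rw [← mul_pow]; simp
  rw [show j + 1 + d - 1 = j + d by omega, show j + 1 + d - (j + 1) = d by omega]
  simp only [zero_sub, pow_add, ne_eq, OfNat.ofNat_ne_zero, not_false_eq_true, zero_pow,
    mul_zero, one_ne_zero]
  field_simp
  push_cast
  ring

/-- Vandermonde's identity at `α + (0 - t)` expresses the moment at `α` through the moments at `0`,
which are `k c_k`. The factor `k / m` turns `m.choose k` into `(m - 1).choose (k - 1)`. -/
theorem binetPoly_eval_eq_sum_binetCoeff {m : ℕ} (hm : 1 ≤ m) (α : ℂ) :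
    (binetPoly m).eval α = binetCoeff m + α * ∑ k ∈ Icc 1 (m - 1),
        ((m - 1).choose (k - 1) : ℂ) * (∏ j ∈ Icc 1 (m - k - 1), (α + (j : ℂ))) *
          binetCoeff k := by
  have hc : ∀ k : ℕ, risingMoment k 0 = k * binetCoeff k := by
    intro k
    rcases Nat.eq_zero_or_pos k with rfl | hk
    · simp [risingMoment_zero]
    · have : (k : ℂ) ≠ 0 := by exact_mod_cast hk.ne'
      rw [binetCoeff_eq_eval_zero, binetPoly_eval_eq_risingMoment hk]
      field_simp
  have hM : risingMoment m α = ∑ k ∈ range (m + 1),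
      (m.choose k : ℂ) * risingProd (m - k) α * (k * binetCoeff k) := by
    simp only [← hc]
    simp only [risingMoment, ← intervalIntegral.integral_const_mul]
    rw [← intervalIntegral.integral_finsetSum
      (fun k _ => Continuous.intervalIntegrable
        (by have := continuous_risingProd k; fun_prop) _ _)]
    congr 1
    ext t
    rw [show α - (t : ℂ) = α + (0 - t) by ring, risingProd_add, mul_sum]
    exact sum_congr rfl fun k _ => by ring
  rw [binetPoly_eval_eq_risingMoment hm, hM]
  obtain ⟨d, rfl⟩ := Nat.exists_eq_add_of_le' hm
  have hd : ((d + 1 : ℕ) : ℂ) ≠ 0 := Nat.cast_ne_zero.2 (by omega)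
  rw [sum_range_succ, sum_range_succ']
  simp only [Nat.choose_self, Nat.sub_self, risingProd_zero, Nat.cast_zero, zero_mul, mul_zero,
    add_zero, Nat.cast_one, one_mul, mul_add, Nat.add_sub_cancel]
  rw [add_comm, ← mul_assoc, one_div_mul_cancel hd, one_mul]
  congr 1
  rw [mul_sum, mul_sum, ← Ico_add_one_right_eq_Icc,
    sum_Ico_eq_sum_range]
  refine sum_congr rfl fun k hk => ?_
  have hk : k < d := mem_range.1 hk
  obtain ⟨e, rfl⟩ := Nat.exists_eq_add_of_lt hk
  rw [show k + e + 1 + 1 - (k + 1) = e + 1 by omega, show 1 + k - 1 = k by omega,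
    show k + e + 1 + 1 - (1 + k) - 1 = e by omega, add_comm 1 k, risingProd_succ_left]
  have h1 : risingProd e (α + 1) = ∏ j ∈ Icc 1 e, (α + (j : ℂ)) := by
    rw [← Ico_add_one_right_eq_Icc, prod_Ico_eq_prod_range, risingProd]
    refine prod_congr rfl fun j _ => ?_
    push_cast
    ring
  have h2 : ((k + e + 1 + 1 : ℕ) : ℂ) * ((k + e + 1).choose k : ℂ) =
      ((k + e + 1 + 1).choose (k + 1) : ℂ) * ((k + 1 : ℕ) : ℂ) := by
    exact_mod_cast Nat.add_one_mul_choose_eq (k + e + 1) k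
  rw [h1]
  field_simp
  linear_combination -((∏ j ∈ Icc 1 e, (α + (j : ℂ))) * α * binetCoeff (k + 1)) * h2

theorem binetPoly_one_eval (α : ℂ) : (binetPoly 1).eval α = 1 / 12 := by
  rw [binetPoly_eval]
  simp [signedStirlingFirst, Nat.stirlingFirst]
  ring

theorem binetPoly_two_eval (α : ℂ) : (binetPoly 2).eval α = α / 12 := by
  rw [binetPoly_eval, show Icc 1 2 = {1, 2} from rfl]
  simp [signedStirlingFirst, Nat.stirlingFirst]
  ring

/-! ### Terms of Gudermann's series -/

/-- The `n`-th term of Gudermann's series for Binet's function is `gudermannTerm (z + n)`. -/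
noncomputable def gudermannTerm (z : ℂ) : ℂ :=
  (z + 1 / 2) * (Complex.log (z + 1) - Complex.log z) - 1

theorem integral_half_sub_div {z : ℂ} (hz : 0 < z.re) :
    ∫ t in (0 : ℝ)..1, (1 / 2 - (t : ℂ)) / (z + t) = gudermannTerm z := by
  have hre : ∀ t ∈ Set.uIcc (0 : ℝ) 1, 0 < (z + t).re := by
    intro t ht
    rw [Set.uIcc_of_le zero_le_one] at ht
    simp only [Complex.add_re, Complex.ofReal_re]
    linarith [ht.1]
  have hne : ∀ t ∈ Set.uIcc (0 : ℝ) 1, z + (t : ℂ) ≠ 0 := fun t ht h => by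
    have := hre t ht
    rw [h] at this
    simp at this
  have h : ∀ t ∈ Set.uIcc (0 : ℝ) 1, HasDerivAt
      (fun t : ℝ => (z + 1 / 2) * Complex.log (z + t) - t) ((1 / 2 - (t : ℂ)) / (z + t)) t := by
    intro t ht
    have h0 : HasDerivAt (fun t : ℝ => z + (t : ℂ)) 1 t := by
      simpa using (Complex.ofRealCLM.hasDerivAt (x := t)).const_add z
    have h1 := ((h0.clog_real (Or.inl (hre t ht))).const_mul (z + 1 / 2)).sub
      (Complex.ofRealCLM.hasDerivAt (x := t))
    refine h1.congr_deriv ?_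
    have := hne t ht
    simp only [Complex.ofRealCLM_apply, Complex.ofReal_one]
    field_simp
    ring
  rw [intervalIntegral.integral_eq_sub_of_hasDerivAt h]
  · simp [gudermannTerm]
    ring
  · exact ContinuousOn.intervalIntegrable (ContinuousOn.div (by fun_prop) (by fun_prop) hne)

theorem norm_half_sub_le {t : ℝ} (ht : t ∈ Set.Icc (0 : ℝ) 1) : ‖1 / 2 - (t : ℂ)‖ ≤ 1 := by
  rw [show (1 / 2 - (t : ℂ)) = ((1 / 2 - t : ℝ) : ℂ) by push_cast; ring, Complex.norm_real,
    Real.norm_eq_abs, abs_le]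
  constructor <;> linarith [ht.1, ht.2]

theorem norm_integral_unitInterval_le {f : ℝ → ℂ} {C : ℝ}
    (h : ∀ t ∈ Set.Icc (0 : ℝ) 1, ‖f t‖ ≤ C) : ‖∫ t in (0 : ℝ)..1, f t‖ ≤ C := by
  have h2 := intervalIntegral.norm_integral_le_of_norm_le_const (a := 0) (b := 1) (f := f) (C := C)
    fun t ht => h t (by rw [Set.uIoc_of_le zero_le_one] at ht; exact ⟨ht.1.le, ht.2⟩)
  simpa using h2

/-- As `1/2 - t` has mean zero, `1/(z + 1/2)` may be subtracted from the kernel `1/(z + t)`, which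
gains a second power of decay. -/
theorem norm_gudermannTerm_le {z : ℂ} {r : ℝ} (hr : 0 < r) (hz : r ≤ z.re) :
    ‖gudermannTerm z‖ ≤ 1 / r ^ 2 := by
  have hre : ∀ s : ℝ, 0 ≤ s → r ≤ ‖z + s‖ := fun s hs => by
    refine le_trans ?_ (Complex.re_le_norm _)
    simp only [Complex.add_re, Complex.ofReal_re]
    linarith
  have hne : ∀ s : ℝ, 0 ≤ s → z + (s : ℂ) ≠ 0 := fun s hs =>
    norm_pos_iff.1 (hr.trans_le (hre s hs))
  have hne2 : z + 1 / 2 ≠ 0 := by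
    have := hne (1 / 2) (by norm_num)
    push_cast at this
    exact this
  have h0 : ∫ t in (0 : ℝ)..1, (1 / 2 - (t : ℂ)) / (z + 1 / 2) = 0 := by
    rw [intervalIntegral.integral_div]
    have := risingMoment_zero 0
    simp only [risingMoment, risingProd_zero, mul_one] at this
    rw [this, zero_div]
  have hmem : ∀ t ∈ Set.uIcc (0 : ℝ) 1, 0 ≤ t := fun t ht => by
    rw [Set.uIcc_of_le zero_le_one] at ht
    exact ht.1
  have h1 : gudermannTerm z =
      ∫ t in (0 : ℝ)..1, (1 / 2 - (t : ℂ)) ^ 2 / ((z + t) * (z + 1 / 2)) := by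
    rw [← integral_half_sub_div (hr.trans_le hz), ← sub_zero (∫ t in (0 : ℝ)..1, _), ← h0,
      ← intervalIntegral.integral_sub]
    · refine intervalIntegral.integral_congr fun t ht => ?_
      have := hne t (hmem t ht)
      rw [div_sub_div _ _ this hne2]
      congr 1
      ring
    · exact ContinuousOn.intervalIntegrable (ContinuousOn.div (by fun_prop) (by fun_prop)
        fun t ht => hne t (hmem t ht))
    · exact Continuous.intervalIntegrable (by fun_prop) _ _
  rw [h1]
  refine norm_integral_unitInterval_le fun t ht => ?_
  have h3 := norm_half_sub_le ht
  have h4 := hre t ht.1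
  have h5 : r ≤ ‖z + 1 / 2‖ := by
    have := hre (1 / 2) (by norm_num)
    push_cast at this
    exact this
  rw [norm_div, norm_pow, norm_mul, sq r]
  gcongr
  exact pow_le_one₀ (norm_nonneg _) h3

theorem summable_one_div_add_one_sq : Summable fun n : ℕ => 1 / ((n : ℝ) + 1) ^ 2 := by
  have := (summable_nat_add_iff 1).2 (Real.summable_one_div_nat_pow.2 one_lt_two)
  simpa using this

theorem summable_gudermannTerm {z : ℂ} (hz : 0 < z.re) :
    Summable fun n : ℕ => gudermannTerm (z + n) := by
  rw [← summable_nat_add_iff 1]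
  refine summable_one_div_add_one_sq.of_norm_bounded fun n => norm_gudermannTerm_le (by positivity) ?_
  simp
  linarith

theorem differentiableAt_gudermannTerm {z : ℂ} (hz : 0 < z.re) :
    DifferentiableAt ℂ gudermannTerm z := by
  have h1 : z ∈ Complex.slitPlane := Or.inl hz
  have h2 : z + 1 ∈ Complex.slitPlane := Or.inl (by simp; linarith)
  unfold gudermannTerm
  fun_prop (disch := assumption)

theorem isOpen_re_pos : IsOpen {z : ℂ | 0 < z.re} :=
  isOpen_lt continuous_const Complex.continuous_re

theorem differentiableOn_tsum_gudermannTerm :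
    DifferentiableOn ℂ (fun z => ∑' n : ℕ, gudermannTerm (z + n)) {z | 0 < z.re} := by
  -- The term `n = 0` is set apart: only the shifted terms have a bound `1/(n+1)^2` uniform on the
  -- half-plane.
  have h : DifferentiableOn ℂ (fun z => ∑' n : ℕ, gudermannTerm (z + (n + 1 : ℕ)))
      {z | 0 < z.re} := by
    refine Complex.differentiableOn_tsum_of_summable_norm summable_one_div_add_one_sq ?_
      isOpen_re_pos ?_
    · intro n z hz
      have hz : 0 < z.re := hz
      have h1 : DifferentiableAt ℂ gudermannTerm (z + (n + 1 : ℕ)) :=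
        differentiableAt_gudermannTerm (by simp; positivity)
      exact (h1.comp (f := fun w : ℂ => w + (n + 1 : ℕ)) z (by fun_prop)).differentiableWithinAt
    · intro n z hz
      have hz : 0 < z.re := hz
      refine norm_gudermannTerm_le (by positivity) ?_
      simp
      linarith
  refine DifferentiableOn.congr (f := fun z => gudermannTerm z +
    ∑' n : ℕ, gudermannTerm (z + (n + 1 : ℕ))) ?_ ?_
  · exact DifferentiableOn.add
      (fun z hz => (differentiableAt_gudermannTerm hz).differentiableWithinAt) h
  · intro z hz
    rw [(summable_gudermannTerm hz).tsum_eq_zero_add]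
    simp

/-! ### Gudermann's series and `log Γ` -/

/-- Gudermann's series for `log Γ`. -/
noncomputable def gudermannLogGamma (z : ℂ) : ℂ :=
  ∑' n : ℕ, gudermannTerm (z + n) + ((z - 1 / 2) * Complex.log z - z +
    1 / 2 * (Real.log (2 * Real.pi) : ℂ))

theorem differentiableOn_gudermannLogGamma :
    DifferentiableOn ℂ gudermannLogGamma {z | 0 < z.re} := by
  refine differentiableOn_tsum_gudermannTerm.add fun z hz => ?_
  have h1 : z ∈ Complex.slitPlane := Or.inl hz
  refine DifferentiableAt.differentiableWithinAt ?_
  fun_prop (disch := assumption)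

theorem sum_gudermannTerm (z : ℂ) (N : ℕ) :
    ∑ n ∈ range N, gudermannTerm (z + n) + (z - 1 / 2) * Complex.log z =
      (z + N - 1 / 2) * Complex.log (z + N) - ∑ n ∈ range N, Complex.log (z + n) - N := by
  induction N with
  | zero => simp
  | succ N ih =>
    rw [sum_range_succ, sum_range_succ, gudermannTerm]
    push_cast
    rw [← add_assoc z]
    linear_combination ih

theorem add_natCast_ne_zero {z : ℂ} (hz : 0 < z.re) (n : ℕ) : z + n ≠ 0 := fun h => by
  have h1 : (z + n).re = 0 := by rw [h]; rfl
  simp at h1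
  have : (0 : ℝ) ≤ n := n.cast_nonneg
  linarith

/-- The partial sum is compared with Euler's limit `GammaSeq`; the two remaining factors, Stirling's
ratio and an exponential, tend to 1. Exponentiating removes any branch question for the sum of
logarithms. -/
theorem exp_partial_gudermann {z : ℂ} (hz : 0 < z.re) {n : ℕ} (hn : n ≠ 0) :
    Complex.exp (∑ k ∈ range (n + 1), gudermannTerm (z + k) + ((z - 1 / 2) * Complex.log z - z +
      1 / 2 * (Real.log (2 * Real.pi) : ℂ))) =
    Complex.GammaSeq z n * (((√Real.pi / Stirling.stirlingSeq n : ℝ) : ℂ) *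
      Complex.exp ((z + n + 1 / 2) * Complex.log (1 + (z + 1) / n) - (z + 1))) := by
  have hn0 : (n : ℂ) ≠ 0 := Nat.cast_ne_zero.2 hn
  have hnr : (0 : ℝ) < n := by positivity
  have hlog : Complex.log (z + (n + 1 : ℕ)) = Complex.log n + Complex.log (1 + (z + 1) / n) := by
    have h1 : z + (n + 1 : ℕ) = ((n : ℝ) : ℂ) * (1 + (z + 1) / n) := by
      push_cast
      field_simp
      ring
    have h2 : 1 + (z + 1) / n ≠ 0 := fun h => add_natCast_ne_zero hz (n + 1) (by rw [h1, h, mul_zero])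
    rw [h1, Complex.log_ofReal_mul hnr h2, Complex.ofReal_log hnr.le, Complex.ofReal_natCast]
  have h1 := sum_gudermannTerm z (n + 1)
  have h2 : Complex.exp (∑ k ∈ range (n + 1), Complex.log (z + k)) =
      ∏ j ∈ range (n + 1), (z + j) := by
    rw [Complex.exp_sum]
    exact prod_congr rfl fun k _ => Complex.exp_log (add_natCast_ne_zero hz k)
  have h3 : ∑ k ∈ range (n + 1), gudermannTerm (z + k) + ((z - 1 / 2) * Complex.log z - z +
      1 / 2 * (Real.log (2 * Real.pi) : ℂ)) =
      Complex.log n * z - ∑ k ∈ range (n + 1), Complex.log (z + k) +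
      ((n * Real.log n - n + 1 / 2 * Real.log n + 1 / 2 * Real.log (2 * Real.pi) : ℝ) : ℂ) +
      ((z + n + 1 / 2) * Complex.log (1 + (z + 1) / n) - (z + 1)) := by
    rw [hlog] at h1
    push_cast at h1 ⊢
    rw [← Complex.natCast_log] at *
    linear_combination h1
  have h4 : Real.exp (n * Real.log n - n + 1 / 2 * Real.log n + 1 / 2 * Real.log (2 * Real.pi)) =
      n.factorial * (√Real.pi / Stirling.stirlingSeq n) := by
    have e1 : Real.exp (n * Real.log n) = (n : ℝ) ^ n := by
      rw [mul_comm, ← Real.rpow_def_of_pos hnr, Real.rpow_natCast]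
    have e2 : Real.exp (1 / 2 * Real.log n) = √n := by
      rw [mul_comm, ← Real.rpow_def_of_pos hnr, Real.sqrt_eq_rpow]
    have e3 : Real.exp (1 / 2 * Real.log (2 * Real.pi)) = √(2 * Real.pi) := by
      rw [mul_comm, ← Real.rpow_def_of_pos (by positivity), Real.sqrt_eq_rpow]
    have e4 : Real.exp (n : ℝ) = Real.exp 1 ^ n := by
      rw [← Real.exp_nat_mul, mul_one]
    rw [Real.exp_add, Real.exp_add, Real.exp_sub, e1, e2, e3, e4, Stirling.stirlingSeq,
      Real.sqrt_mul zero_le_two, Real.sqrt_mul zero_le_two, div_pow]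
    have : (n.factorial : ℝ) ≠ 0 := by positivity
    field_simp
  rw [h3, Complex.exp_add, Complex.exp_add, Complex.exp_sub, h2, ← Complex.cpow_def_of_ne_zero hn0,
    ← Complex.ofReal_exp, h4, Complex.GammaSeq]
  push_cast
  ring

theorem exp_gudermannLogGamma {z : ℂ} (hz : 0 < z.re) :
    Complex.exp (gudermannLogGamma z) = Complex.Gamma z := by
  have hlog : Tendsto (fun n : ℕ => (n : ℂ) * Complex.log (1 + (z + 1) / n)) atTop (𝓝 (z + 1)) := by
    refine Complex.tendsto_nat_mul_log_one_add_of_tendsto (tendsto_const_nhds.congr' ?_)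
    filter_upwards [eventually_ne_atTop 0] with n hn
    have : (n : ℂ) ≠ 0 := Nat.cast_ne_zero.2 hn
    field_simp
  have hinv : Tendsto (fun n : ℕ => ((n : ℂ))⁻¹) atTop (𝓝 0) := tendsto_inv_atTop_nhds_zero_nat
  have hlog2 : Tendsto (fun n : ℕ => (z + n + 1 / 2) * Complex.log (1 + (z + 1) / n) - (z + 1))
      atTop (𝓝 0) := by
    have h := (hlog.add ((hinv.mul hlog).const_mul (z + 1 / 2))).sub_const (z + 1)
    simp only [zero_mul, mul_zero, add_zero, sub_self] at h
    refine h.congr' ?_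
    filter_upwards [eventually_ne_atTop 0] with n hn
    have : (n : ℂ) ≠ 0 := Nat.cast_ne_zero.2 hn
    field_simp
    ring
  have hst : Tendsto (fun n : ℕ => ((√Real.pi / Stirling.stirlingSeq n : ℝ) : ℂ)) atTop (𝓝 1) := by
    have hpi : √Real.pi ≠ 0 := by positivity
    have h := (tendsto_const_nhds (x := √Real.pi)).div Stirling.tendsto_stirlingSeq_sqrt_pi hpi
    rw [div_self hpi] at h
    exact (Complex.continuous_ofReal.tendsto 1).comp h
  have h1 := (Complex.GammaSeq_tendsto_Gamma z).mul
    (hst.mul ((Complex.continuous_exp.tendsto 0).comp hlog2))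
  simp only [Complex.exp_zero, mul_one] at h1
  have h2 := (Complex.continuous_exp.tendsto _).comp
    ((((summable_gudermannTerm hz).hasSum.tendsto_sum_nat).comp (tendsto_add_atTop_nat 1)).add_const
      ((z - 1 / 2) * Complex.log z - z + 1 / 2 * (Real.log (2 * Real.pi) : ℂ)))
  refine tendsto_nhds_unique h2 (h1.congr' ?_)
  filter_upwards [eventually_ne_atTop 0] with n hn
  exact (exp_partial_gudermann hz hn).symm

/-- The exponential fixes the value only modulo `2πi`; it is zero because every term of the series
is real. -/
theorem gudermannLogGamma_one : gudermannLogGamma 1 = 0 := by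
  have hre : ∀ n : ℕ, (gudermannTerm (1 + n)).im = 0 := by
    intro n
    have h : gudermannTerm (1 + n) = (((1 + n + 1 / 2) *
        (Real.log (1 + n + 1) - Real.log (1 + n)) - 1 : ℝ) : ℂ) := by
      rw [gudermannTerm]
      push_cast
      rw [Complex.ofReal_log (by positivity), Complex.ofReal_log (by positivity)]
      push_cast
      rfl
    rw [h, Complex.ofReal_im]
  have him : (gudermannLogGamma 1).im = 0 := by
    have h := Complex.hasSum_im (summable_gudermannTerm (z := 1) (by simp)).hasSum
    simp only [hre] at h
    simp [gudermannLogGamma, ← hasSum_zero.unique h]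
  have h2 : gudermannLogGamma 1 = ((gudermannLogGamma 1).re : ℂ) := Complex.ext rfl (by simpa using him)
  have h3 := exp_gudermannLogGamma (z := 1) (by simp)
  rw [Complex.Gamma_one, h2] at h3
  have h4 : Real.exp (gudermannLogGamma 1).re = 1 := by exact_mod_cast h3
  rw [Real.exp_eq_one_iff] at h4
  rw [h2, h4, Complex.ofReal_zero]

theorem hasDerivAt_gudermannLogGamma {z : ℂ} (hz : 0 < z.re) :
    HasDerivAt gudermannLogGamma (Complex.digamma z) z := by
  have hmem : {z : ℂ | 0 < z.re} ∈ 𝓝 z := isOpen_re_pos.mem_nhds hz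
  have h := (differentiableOn_gudermannLogGamma.differentiableAt hmem).hasDerivAt
  have h1 : HasDerivAt Complex.Gamma
      (Complex.exp (gudermannLogGamma z) * deriv gudermannLogGamma z) z := by
    refine h.cexp.congr_of_eventuallyEq ?_
    filter_upwards [hmem] with w hw
    exact (exp_gudermannLogGamma hw).symm
  refine h.congr_deriv ?_
  rw [Complex.digamma_def, logDeriv_apply, h1.deriv, ← exp_gudermannLogGamma hz,
    mul_div_cancel_left₀ _ (Complex.exp_ne_zero _)]

theorem continuousOn_digamma : ContinuousOn Complex.digamma {z | 0 < z.re} := by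
  refine (differentiableOn_gudermannLogGamma.deriv isOpen_re_pos).continuousOn.congr fun z hz => ?_
  exact (hasDerivAt_gudermannLogGamma hz).deriv.symm

/-- Both sides are primitives of digamma that vanish at 1, and the segment from 1 to `z` stays in
the right half-plane. -/
theorem logGamma_eq_gudermannLogGamma {z : ℂ} (hz : 0 < z.re) :
    logGamma z = gudermannLogGamma z := by
  have hre : ∀ t ∈ Set.uIcc (0 : ℝ) 1, 0 < (1 + (t : ℂ) * (z - 1)).re := by
    intro t ht
    rw [Set.uIcc_of_le zero_le_one] at ht
    simp
    rcases eq_or_lt_of_le ht.1 with h | h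
    · simp [← h]
    · nlinarith [ht.2, mul_pos h hz]
  have hd : ∀ t ∈ Set.uIcc (0 : ℝ) 1, HasDerivAt
      (fun t : ℝ => gudermannLogGamma (1 + (t : ℂ) * (z - 1)))
      (Complex.digamma (1 + (t : ℂ) * (z - 1)) * (z - 1)) t := by
    intro t ht
    have h0 : HasDerivAt (fun t : ℝ => 1 + (t : ℂ) * (z - 1)) (z - 1) t := by
      simpa using ((Complex.ofRealCLM.hasDerivAt (x := t)).mul_const (z - 1)).const_add 1
    exact (hasDerivAt_gudermannLogGamma (hre t ht)).comp t h0
  rw [logGamma, segmentIntegral, intervalIntegral.integral_eq_sub_of_hasDerivAt hd]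
  · simp [gudermannLogGamma_one]
  · refine ContinuousOn.intervalIntegrable ?_
    exact (continuousOn_digamma.comp (by fun_prop) hre).mul continuousOn_const

/-- Gudermann's series for Binet's function. -/
theorem hasSum_gudermannTerm {z : ℂ} (hz : 0 < z.re) :
    HasSum (fun n : ℕ => gudermannTerm (z + n)) (binetMu z) := by
  have h : binetMu z = ∑' n : ℕ, gudermannTerm (z + n) := by
    rw [binetMu, logGamma_eq_gudermannLogGamma hz, gudermannLogGamma]
    ring
  rw [h]
  exact (summable_gudermannTerm hz).hasSum

/-! ### Telescoping sums of reciprocal rising factorials -/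

theorem risingProd_ne_zero {R : Type*} [Field R] {w : R} (hw : ∀ k : ℕ, w + k ≠ 0) (m : ℕ) :
    risingProd m w ≠ 0 :=
  prod_ne_zero_iff.2 fun k _ => hw k

/-- Telescopes because `(w + N) - (x + N) = w - x`. -/
theorem sum_risingProd_div_risingProd {R : Type*} [Field R] {w x : R} (hw : ∀ k : ℕ, w + k ≠ 0)
    (hwx : w - x ≠ 0) (N : ℕ) :
    ∑ m ∈ range N, risingProd m x / risingProd (m + 1) w =
      (1 - risingProd N x / risingProd N w) / (w - x) := by
  induction N with
  | zero => simp [risingProd_zero]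
  | succ N ih =>
    have h1 := risingProd_ne_zero hw N
    have h2 := hw N
    rw [sum_range_succ, ih, risingProd_succ, risingProd_succ]
    field_simp
    ring

/-- Telescopes because `1/(w)_{m+1} - 1/(w+1)_{m+1} = (m+1)/(w)_{m+2}`. -/
theorem sum_one_div_risingProd {R : Type*} [Field R] [CharZero R] {w : R}
    (hw : ∀ k : ℕ, w + k ≠ 0) (m N : ℕ) :
    ∑ n ∈ range N, 1 / risingProd (m + 2) (w + n) =
      (1 / risingProd (m + 1) w - 1 / risingProd (m + 1) (w + N)) / ((m : R) + 1) := by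
  have hm : (m : R) + 1 ≠ 0 := by exact_mod_cast Nat.succ_ne_zero m
  induction N with
  | zero => simp
  | succ N ih =>
    have hN : ∀ k : ℕ, w + N + k ≠ 0 := fun k => by
      have := hw (N + k)
      push_cast at this
      rwa [add_assoc]
    have h1 := risingProd_ne_zero hN (m + 1)
    have h2 := hN (m + 1)
    have h3 : w + N ≠ 0 := hw N
    have h4 : risingProd (m + 1) (w + N) * (w + N + (m + 1 : ℕ)) =
        (w + N) * risingProd (m + 1) (w + N + 1) := by
      rw [← risingProd_succ, risingProd_succ_left]
    have h5 : risingProd (m + 1) (w + N + 1) ≠ 0 := by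
      refine right_ne_zero_of_mul (a := w + N) ?_
      rw [← h4]
      exact mul_ne_zero h1 h2
    have h6 : 1 / risingProd (m + 2) (w + N) = (1 / risingProd (m + 1) (w + N) -
        1 / risingProd (m + 1) (w + N + 1)) / ((m : R) + 1) := by
      rw [risingProd_succ]
      push_cast at h2 h4 ⊢
      field_simp
      linear_combination h4
    rw [sum_range_succ, ih, h6]
    push_cast
    rw [← add_assoc]
    ring

theorem tendsto_one_div_risingProd (m : ℕ) (w : ℂ) :
    Tendsto (fun n : ℕ => 1 / risingProd (m + 1) (w + n)) atTop (𝓝 0) := by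
  have h : ∀ k ∈ range (m + 1), Tendsto (fun n : ℕ => (w + n + (k : ℂ))⁻¹) atTop (𝓝 0) := by
    intro k _
    refine (tendsto_inv₀_cobounded.comp ((tendsto_const_add_cobounded (w + k)).comp
      tendsto_natCast_atTop_cobounded)).congr fun n => ?_
    simp only [Function.comp_apply]
    ring
  have h2 := tendsto_finsetProd (range (m + 1)) h
  simpa [risingProd] using h2

theorem norm_risingProd_ge {w : ℂ} {u : ℝ} (hu : 0 ≤ u) (hw : u ≤ w.re) (m : ℕ) :
    risingProd m u ≤ ‖risingProd m w‖ := by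
  rw [risingProd, risingProd, norm_prod]
  refine prod_le_prod (fun k _ => by positivity) fun k _ => le_trans ?_ (Complex.re_le_norm _)
  simpa using hw

theorem risingProd_pos {u : ℝ} (hu : 0 < u) (m : ℕ) : 0 < risingProd m u :=
  prod_pos fun k _ => by positivity

theorem hasSum_one_div_risingProd_real {u : ℝ} (hu : 0 < u) (m : ℕ) :
    HasSum (fun n : ℕ => 1 / risingProd (m + 2) (u + n)) (1 / risingProd (m + 1) u / (m + 1)) := by
  rw [hasSum_iff_tendsto_nat_of_nonneg
    (fun n => (one_div_pos.2 (risingProd_pos (by positivity) _)).le)]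
  have h := tendsto_one_div_risingProd m (u : ℂ)
  have h1 : ∀ n : ℕ, 1 / risingProd (m + 1) ((u : ℂ) + n) =
      ((1 / risingProd (m + 1) (u + n) : ℝ) : ℂ) := fun n => by simp [risingProd]
  simp only [h1] at h
  have h2 : Tendsto (fun n : ℕ => 1 / risingProd (m + 1) (u + n)) atTop (𝓝 0) := by
    exact tendsto_ofReal_iff.1 (by simpa only [Complex.ofReal_zero] using h)
  have h3 := (h2.const_sub (1 / risingProd (m + 1) u)).div_const ((m : ℝ) + 1)
  rw [sub_zero] at h3
  exact h3.congr fun N => (sum_one_div_risingProd (fun k => by positivity) m N).symm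

theorem hasSum_one_div_risingProd {w : ℂ} (hw : 0 < w.re) (m : ℕ) :
    HasSum (fun n : ℕ => 1 / risingProd (m + 2) (w + n)) (1 / risingProd (m + 1) w / (m + 1)) := by
  have hs : Summable fun n : ℕ => 1 / risingProd (m + 2) (w + n) := by
    refine (hasSum_one_div_risingProd_real hw m).summable.of_norm_bounded fun n => ?_
    rw [norm_div, norm_one]
    exact one_div_le_one_div_of_le (risingProd_pos (by positivity) _)
      (norm_risingProd_ge (by positivity) (by simp) _)
  have h3 := ((tendsto_one_div_risingProd m w).const_sub
    (1 / risingProd (m + 1) w)).div_const ((m : ℂ) + 1)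
  rw [sub_zero] at h3
  rw [← tendsto_nhds_unique hs.hasSum.tendsto_sum_nat (h3.congr fun N =>
    (sum_one_div_risingProd (add_natCast_ne_zero hw) m N).symm)]
  exact hs.hasSum

/-! ### Growth of rising factorials -/

theorem summable_risingProd_div_risingProd {u v : ℝ} (hv : 0 < v) (huv : v < u) :
    Summable fun m : ℕ => risingProd m v / risingProd (m + 1) u := by
  have hu : 0 < u := hv.trans huv
  refine summable_of_sum_range_le (c := 1 / (u - v))
    (fun m => (div_pos (risingProd_pos hv _) (risingProd_pos hu _)).le) fun N => ?_
  rw [sum_risingProd_div_risingProd (fun k => by positivity) (sub_pos.2 huv).ne']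
  have : 0 < risingProd N v / risingProd N u := div_pos (risingProd_pos hv _) (risingProd_pos hu _)
  have := sub_pos.2 huv
  gcongr
  linarith

/-- By Euler's limit the ratio behaves like `n^(v - u) Γ(u)/Γ(v)`. -/
theorem tendsto_risingProd_div_risingProd {u v : ℝ} (hv : 0 < v) (huv : v < u) :
    Tendsto (fun m : ℕ => risingProd m v / risingProd m u) atTop (𝓝 0) := by
  have hu : 0 < u := hv.trans huv
  rw [← tendsto_add_atTop_iff_nat 1]
  have h1 := (Real.GammaSeq_tendsto_Gamma u).div (Real.GammaSeq_tendsto_Gamma v)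
    (Real.Gamma_pos_of_pos hv).ne'
  have h2 : Tendsto (fun n : ℕ => (n : ℝ) ^ (-(u - v))) atTop (𝓝 0) :=
    (tendsto_rpow_neg_atTop (sub_pos.2 huv)).comp tendsto_natCast_atTop_atTop
  have h3 := h2.mul h1
  rw [zero_mul] at h3
  refine h3.congr' ?_
  filter_upwards [eventually_ne_atTop 0] with n hn
  have hn : (0 : ℝ) < n := by positivity
  have hf : (n.factorial : ℝ) ≠ 0 := by positivity
  have hU := (risingProd_pos hu (n + 1)).ne'
  have hV := (risingProd_pos hv (n + 1)).ne'
  have e1 : (n : ℝ) ^ v = (n : ℝ) ^ (-(u - v)) * (n : ℝ) ^ u := by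
    rw [← Real.rpow_add hn]
    congr 1
    ring
  have e2 : (n : ℝ) ^ v ≠ 0 := by positivity
  simp only [Pi.div_apply, Real.GammaSeq]
  change (n : ℝ) ^ (-(u - v)) * ((n : ℝ) ^ u * n.factorial / risingProd (n + 1) u /
    ((n : ℝ) ^ v * n.factorial / risingProd (n + 1) v)) = _
  have e3 : (n : ℝ) ^ (-(u - v)) * (n : ℝ) ^ u / (n : ℝ) ^ v = 1 := by
    rw [← e1, div_self e2]
  calc _ = (n : ℝ) ^ (-(u - v)) * (n : ℝ) ^ u / (n : ℝ) ^ v *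
        (risingProd (n + 1) v / risingProd (n + 1) u) := by field_simp
    _ = _ := by rw [e3, one_mul]

/-- Products of uniformly bounded factors that are eventually dominated by `b` are dominated by
a constant multiple of the products of `b`. -/
theorem exists_prod_le_const_mul_prod {ι : Type*} {a : ι → ℕ → ℝ} {b M : ℕ → ℝ} {K : ℕ}
    (ha : ∀ i k, 0 ≤ a i k) (hM : ∀ i k, a i k ≤ M k) (hM0 : ∀ k, 0 ≤ M k) (hb : ∀ k, 0 < b k)
    (hab : ∀ i, ∀ k ≥ K, a i k ≤ b k) :
    ∃ C : ℝ, 0 ≤ C ∧ ∀ i m, ∏ k ∈ range m, a i k ≤ C * ∏ k ∈ range m, b k := by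
  have hB : ∀ m, 0 < ∏ k ∈ range m, b k := fun m => prod_pos fun k _ => hb k
  have h0 : ∀ j, 0 ≤ (∏ k ∈ range j, M k) / ∏ k ∈ range j, b k := fun j =>
    div_nonneg (prod_nonneg fun k _ => hM0 k) (hB j).le
  -- The sum of the prefix ratios up to `K` dominates each of them; beyond `K` each new factor is at
  -- most that of `b`.
  refine ⟨∑ j ∈ range (K + 1), (∏ k ∈ range j, M k) / ∏ k ∈ range j, b k,
    sum_nonneg fun j _ => h0 j, fun i m => ?_⟩
  have hsmall : ∀ m ≤ K, ∏ k ∈ range m, a i k ≤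
      (∑ j ∈ range (K + 1), (∏ k ∈ range j, M k) / ∏ k ∈ range j, b k) *
        ∏ k ∈ range m, b k := by
    intro m hm
    rw [← div_le_iff₀ (hB m)]
    refine le_trans ?_ (single_le_sum (fun j _ => h0 j) (mem_range.2 (Nat.lt_succ_of_le hm)))
    have := hB m
    gcongr
    · exact fun k _ => ha i k
    · exact hM i _
  rcases le_total m K with h | h
  · exact hsmall m h
  · induction m, h using Nat.le_induction with
    | base => exact hsmall K le_rfl
    | succ m hm ih =>
      rw [prod_range_succ, prod_range_succ, ← mul_assoc]
      exact mul_le_mul ih (hab i m hm) (ha i m)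
        (mul_nonneg (sum_nonneg fun j _ => h0 j) (hB m).le)

theorem exists_norm_risingProd_sub_le (α : ℂ) {v : ℝ} (hv : 0 < v) (hαv : α.re < v) :
    ∃ C : ℝ, 0 ≤ C ∧ ∀ t ∈ Set.Icc (0 : ℝ) 1, ∀ m,
      ‖risingProd m (α - t)‖ ≤ C * risingProd m v := by
  -- The first bound makes `Re(α - t + k) ≥ 0`, so its square is at most `(Re α + k)^2`; the second
  -- gives `(Im α)^2 ≤ (v + k)^2 - (Re α + k)^2`.
  obtain ⟨K, hK⟩ := exists_nat_ge (max (1 - α.re) ((α.im ^ 2 / (v - α.re) - v - α.re) / 2))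
  obtain ⟨C, hC, h⟩ := exists_prod_le_const_mul_prod (ι := Set.Icc (0 : ℝ) 1)
    (a := fun t k => ‖α - (t : ℝ) + k‖) (b := fun k => v + k) (M := fun k => ‖α‖ + 1 + k) (K := K)
    (fun _ _ => norm_nonneg _)
    (fun t k => by
      refine (norm_add_le _ _).trans ?_
      have h1 : ‖α - ((t : ℝ) : ℂ)‖ ≤ ‖α‖ + 1 := by
        refine (norm_sub_le _ _).trans ?_
        rw [Complex.norm_real, Real.norm_eq_abs, abs_of_nonneg t.2.1]
        linarith [t.2.2]
      simpa using h1)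
    (fun k => by positivity) (fun k => by positivity)
    (fun t k hk => by
      have hk' : (K : ℝ) ≤ k := by exact_mod_cast hk
      have h1 := (le_max_left _ _).trans hK
      have h2 := (le_max_right _ _).trans hK
      have hd : 0 < v - α.re := by linarith
      have h3 : α.im ^ 2 ≤ (v + α.re + 2 * k) * (v - α.re) := by
        rw [← div_le_iff₀ hd]
        linarith
      obtain ⟨t, ht0, ht1⟩ := t
      rw [Complex.norm_def, Real.sqrt_le_left (by positivity), Complex.normSq_apply]
      simp
      nlinarith)
  refine ⟨C, hC, fun t ht m => ?_⟩
  rw [risingProd, norm_prod]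
  exact h ⟨t, ht⟩ m

/-! ### The factorial expansion -/

/-- Integrating the finite expansion of `1/(z + t)` leaves a remainder of size at most a constant
times `(v)_N / (u)_N`, with `u = Re(z + α)`. This identifies the limit of the partial sums;
summability is supplied later by the double family. -/
theorem hasSum_risingMoment_div {z α : ℂ} {v C : ℝ} (hz : 0 < z.re) (hv : 0 < v)
    (hvu : v < (z + α).re) (hC : ∀ t ∈ Set.Icc (0 : ℝ) 1, ∀ m,
      ‖risingProd m (α - t)‖ ≤ C * risingProd m v)
    (hs : Summable fun m => risingMoment m α / risingProd (m + 1) (z + α)) :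
    HasSum (fun m => risingMoment m α / risingProd (m + 1) (z + α)) (gudermannTerm z) := by
  have hu : 0 < (z + α).re := hv.trans hvu
  have hzt : ∀ t ∈ Set.Icc (0 : ℝ) 1, z.re ≤ ‖z + (t : ℂ)‖ := fun t ht => by
    refine le_trans ?_ (Complex.re_le_norm _)
    simpa using ht.1
  have hne : ∀ t ∈ Set.Icc (0 : ℝ) 1, z + (t : ℂ) ≠ 0 := fun t ht =>
    norm_pos_iff.1 (hz.trans_le (hzt t ht))
  have hI : Set.uIcc (0 : ℝ) 1 = Set.Icc 0 1 := Set.uIcc_of_le zero_le_one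
  have hpart : ∀ N, ∑ m ∈ range N, risingMoment m α / risingProd (m + 1) (z + α) =
      gudermannTerm z - ∫ t in (0 : ℝ)..1, (1 / 2 - (t : ℂ)) / (z + t) *
        (risingProd N (α - t) / risingProd N (z + α)) := by
    intro N
    have hcont : ContinuousOn (fun t : ℝ => (1 / 2 - (t : ℂ)) / (z + t)) (Set.uIcc 0 1) :=
      ContinuousOn.div (by fun_prop) (by fun_prop) (by rw [hI]; exact hne)
    have hc := continuous_risingProd
    have hrem : ContinuousOn (fun t : ℝ => (1 / 2 - (t : ℂ)) / (z + t) *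
        (risingProd N (α - t) / risingProd N (z + α))) (Set.uIcc 0 1) :=
      hcont.mul (Continuous.continuousOn (by fun_prop))
    rw [← integral_half_sub_div hz, ← intervalIntegral.integral_sub hcont.intervalIntegrable
      hrem.intervalIntegrable]
    simp only [risingMoment, ← intervalIntegral.integral_div]
    rw [← intervalIntegral.integral_finsetSum
      (fun k _ => Continuous.intervalIntegrable (by fun_prop) _ _)]
    refine intervalIntegral.integral_congr fun t ht => ?_
    have h1 : z + α - (α - t) = z + t := by ring
    have h2 := sum_risingProd_div_risingProd (x := α - t) (add_natCast_ne_zero hu)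
      (by rw [h1]; exact hne t (hI ▸ ht)) N
    simp only [mul_div_assoc]
    rw [← mul_sum, h2, h1]
    ring
  have hrem : Tendsto (fun N => ∫ t in (0 : ℝ)..1, (1 / 2 - (t : ℂ)) / (z + t) *
      (risingProd N (α - t) / risingProd N (z + α))) atTop (𝓝 0) := by
    have h1 := (tendsto_risingProd_div_risingProd hv hvu).const_mul (1 / z.re * C)
    rw [mul_zero] at h1
    refine squeeze_zero_norm (fun N => norm_integral_unitInterval_le fun t ht => ?_) h1
    rw [norm_mul, norm_div, norm_div, mul_assoc (1 / z.re), ← mul_div_assoc C]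
    have h2 := norm_half_sub_le ht
    have h3 := hzt t ht
    have h4 := hC t ht N
    have h5 := norm_risingProd_ge hu.le le_rfl N
    have h6 := risingProd_pos hu N
    have h7 := (norm_nonneg _).trans h4
    gcongr
  have h := hrem.const_sub (gudermannTerm z)
  rw [sub_zero] at h
  rw [← tendsto_nhds_unique hs.hasSum.tendsto_sum_nat (h.congr fun N => (hpart N).symm)]
  exact hs.hasSum

theorem hasSum_binetPoly {z α : ℂ} (hz : 0 < z.re) (hα : -z.re < α.re) :
    HasSum (fun n : ℕ => (binetPoly (n + 1)).eval α / risingProd (n + 1) (z + α)) (binetMu z) := by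
  set u := (z + α).re with hu_def
  have hu : 0 < u := by simp [hu_def]; linarith
  obtain ⟨v, hv1, hvu⟩ := exists_between (max_lt hu (show α.re < u by simp [hu_def]; linarith))
  obtain ⟨hv, hαv⟩ := max_lt_iff.1 hv1
  obtain ⟨C, hC0, hC⟩ := exists_norm_risingProd_sub_le α hv hαv
  have hre : ∀ n : ℕ, u + n = (z + n + α).re := fun n => by simp [hu_def]; ring
  have hmom : ∀ m, ‖risingMoment m α‖ ≤ C * risingProd m v := fun m =>
    norm_integral_unitInterval_le fun t ht => by
      rw [norm_mul]
      refine le_trans ?_ (hC t ht m)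
      exact mul_le_of_le_one_left (norm_nonneg _) (norm_half_sub_le ht)
  -- The first index starts at the moment of order 1. Order 0 vanishes, and each denominator now has
  -- at least two factors, as summation over `n` requires.
  let F : ℕ × ℕ → ℂ := fun p => risingMoment (p.1 + 1) α / risingProd (p.1 + 2) (z + p.2 + α)
  let B : ℕ × ℕ → ℝ := fun p => C * risingProd (p.1 + 1) v / risingProd (p.1 + 2) (u + p.2)
  have hBsum : ∀ m : ℕ, HasSum (fun n => B (m, n))
      (C * risingProd (m + 1) v * (1 / risingProd (m + 1) u / (m + 1))) := fun m => by
    simpa only [B, mul_one_div] using (hasSum_one_div_risingProd_real hu m).mul_left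
      (C * risingProd (m + 1) v)
  have hB : Summable B := by
    rw [summable_prod_of_nonneg]
    · refine ⟨fun m => (hBsum m).summable, ?_⟩
      simp only [fun m => (hBsum m).tsum_eq]
      have h1 := (((summable_nat_add_iff 1).2
        (summable_risingProd_div_risingProd hv hvu)).mul_left (C * (u + 1)))
      refine h1.of_nonneg_of_le (fun m => ?_) fun m => ?_
      · have := risingProd_pos hu (m + 1)
        have := risingProd_pos hv (m + 1)
        positivity
      · have hU := risingProd_pos hu (m + 1)
        have hV := risingProd_pos hv (m + 1)
        rw [risingProd_succ (m + 1) u]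
        -- Trades the factor `1/(m+1)` for one more factor of `(u)_{m+2}`, reaching the summable
        -- series of `(v)_{m+1} / (u)_{m+2}`.
        have h2 : (1 : ℝ) / (m + 1) ≤ (u + 1) / (u + (m + 1 : ℕ)) := by
          push_cast
          rw [div_le_div_iff₀ (by positivity) (by positivity)]
          nlinarith [mul_nonneg hu.le (m.cast_nonneg (α := ℝ))]
        calc _ = C * (risingProd (m + 1) v / risingProd (m + 1) u) * (1 / (m + 1)) := by
              field_simp
          _ ≤ C * (risingProd (m + 1) v / risingProd (m + 1) u) *
                ((u + 1) / (u + (m + 1 : ℕ))) := by gcongr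
          _ = _ := by field_simp
    · intro p
      have := risingProd_pos (u := u + p.2) (by positivity) (p.1 + 2)
      have := risingProd_pos hv (p.1 + 1)
      change 0 ≤ C * risingProd (p.1 + 1) v / risingProd (p.1 + 2) (u + p.2)
      positivity
  have hF : Summable F := by
    refine hB.of_norm_bounded fun p => ?_
    simp only [F, B, norm_div]
    have h1 := hmom (p.1 + 1)
    have h2 := norm_risingProd_ge (w := z + p.2 + α) (u := u + p.2) (by positivity) (hre p.2).le
      (p.1 + 2)
    have h3 := risingProd_pos (u := u + p.2) (by positivity) (p.1 + 2)
    have h4 := (norm_nonneg _).trans h1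
    gcongr
  have hrow : ∀ m : ℕ, HasSum (fun n => F (m, n))
      ((binetPoly (m + 1)).eval α / risingProd (m + 1) (z + α)) := fun m => by
    have h := (hasSum_one_div_risingProd hu m).mul_left (risingMoment (m + 1) α)
    rw [binetPoly_eval_eq_risingMoment (Nat.succ_pos m)]
    have h1 : 1 / ((m + 1 : ℕ) : ℂ) * risingMoment (m + 1) α / risingProd (m + 1) (z + α) =
        risingMoment (m + 1) α * (1 / risingProd (m + 1) (z + α) / (m + 1)) := by
      push_cast
      ring
    rw [h1]
    simpa only [F, mul_one_div, add_right_comm z] using h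
  have hcol : ∀ n : ℕ, HasSum (fun m => F (m, n)) (gudermannTerm (z + n)) := fun n => by
    have hsF : Summable fun m => F (m, n) := hF.prod_symm.prod_factor n
    have hs : Summable fun m => risingMoment m α / risingProd (m + 1) (z + n + α) :=
      (summable_nat_add_iff 1).1 hsF
    have h := hasSum_risingMoment_div (z := z + n) (by simp; positivity) hv
      (by rw [← hre]; linarith [n.cast_nonneg (α := ℝ)]) hC hs
    rw [← hasSum_nat_add_iff' 1] at h
    simpa [risingMoment_zero] using h
  -- Summing over `n` first gives the factorial series, over `m` first Gudermann's series.
  have h1 := hF.hasSum.prod_fiberwise hrow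
  have h2 := hF.prod_symm.hasSum.prod_fiberwise hcol
  have h3 : ∑' p, F p = binetMu z := by
    rw [← h2.unique (hasSum_gudermannTerm hz)]
    exact ((Equiv.prodComm ℕ ℕ).tsum_eq F).symm
  rwa [h3] at h1

theorem theorem3 :
    -- the convergent factorial series
    (∀ z α : ℂ, 0 < z.re → -z.re < α.re →
      HasSum (fun n : ℕ => (binetPoly (n + 1)).eval α / ∏ k ∈ Finset.range (n + 1), (z + α + (k : ℂ)))
        (binetMu z)) ∧
    -- the Binet polynomials through Stirling numbers of the first kind
    (∀ m : ℕ, 1 ≤ m → ∀ α : ℂ,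
      (binetPoly m).eval α = 1 / (m : ℂ) * ∑ k ∈ Finset.Icc 1 m,
        ((α ^ (k + 2) - (α - 1) ^ (k + 2)) / ((k : ℂ) + 2) +
          (1 / 2 - α) * (α ^ (k + 1) - (α - 1) ^ (k + 1)) / ((k : ℂ) + 1)) *
        (-1) ^ (m - k) * (signedStirlingFirst m k : ℂ)) ∧
    -- the coefficients are the values at `α = 0`
    (∀ m : ℕ, 1 ≤ m → binetCoeff m = (binetPoly m).eval 0) ∧
    -- the Binet polynomials through these coefficients
    (∀ m : ℕ, 1 ≤ m → ∀ α : ℂ,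
      (binetPoly m).eval α = binetCoeff m + α * ∑ k ∈ Finset.Icc 1 (m - 1),
        ((m - 1).choose (k - 1) : ℂ) * (∏ j ∈ Finset.Icc 1 (m - k - 1), (α + (j : ℂ))) *
          binetCoeff k) ∧
    -- the integral representation
    (∀ m : ℕ, 1 ≤ m → ∀ α : ℂ,
      (binetPoly m).eval α = 1 / (m : ℂ) *
        segmentIntegral (fun x => (x + (1 / 2 - α)) * ∏ k ∈ Finset.range m, ((k : ℂ) + x))
          (α - 1) α) ∧
    -- the first two
    (∀ α : ℂ, (binetPoly 1).eval α = 1 / 12) ∧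
    (∀ α : ℂ, (binetPoly 2).eval α = α / 12) := by
  exact ⟨fun _ _ hz hα => hasSum_binetPoly hz hα, fun m _ α => binetPoly_eval m α,
    fun m _ => binetCoeff_eq_eval_zero m, fun _ hm α => binetPoly_eval_eq_sum_binetCoeff hm α,
    fun _ hm α => binetPoly_eval_eq_segmentIntegral hm α, binetPoly_one_eval, binetPoly_two_eval⟩
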